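/- Let $X$ and $Y$ be Banach spaces over $\mathbb{K}\in\{\mathbb{R},\mathbb{C}\}$. A subspace $M$ of a Banach space $Z$ is called 1-complemented if there is a bounded linear projection $P:Z\to Z$ with $P(Z)=M$ and $\|P\|\le 1$. The space $Z$ has the metric $\pi$-property if for every $\varepsilon>0$ and every finite set $\{z_1,\dots,z_n\}$ of norm-one vectors of $Z$ there are a finite-dimensional 1-complemented subspace $M\subseteq Z$ and vectors $z_1',\dots,z_n'\in M$ with $\|z_i-z_i'\|<\varepsilon$ for $i=1,\dots,n$. Let $X\widehat{\otimes}_\pi Y$ be the projective tensor product, that is, the completion of $X\otimes Y$ under the projective norm $\|u\|_\pi=\inf\{\sum_{i}\|x_i\|\|y_i\| : u=\sum_{i}x_i\otimes y_i\}$, where the infimum is over all finite representations of $u$. A tensor $z\in X\widehat{\otimes}_\pi Y$ attains its projective norm if there are bounded sequences $(x_n)\subseteq X$ and $(y_n)\subseteq Y$ such that $\sum_{n=1}^\infty\|x_n\|\|y_n\|<\infty$, $z=\sum_{n=1}^\infty x_n\otimes y_n$ and $\|z\|_\pi=\sum_{n=1}^\infty\|x_n\|\|y_n\|$. Let $\operatorname{NA}_\pi(X\widehat{\otimes}_\pi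 Y)$ be the set of all such tensors. **Theorem.** Suppose that $X$ has the metric $\pi$-property. (a) If $Y$ has the metric $\pi$-property, then $\overline{\operatorname{NA}_\pi(X\widehat{\otimes}_\pi Y)}^{\|\cdot\|_\pi}=X\widehat{\otimes}_\pi Y$. (b) If $Y$ is uniformly convex, then $\overline{\operatorname{NA}_\pi(X\widehat{\otimes}_\pi Y)}^{\|\cdot\|_\pi}=X\widehat{\otimes}_\pi Y$. -/

import Mathlib

open scoped TensorProduct

noncomputable section

/-- A subspace `M` of `X` is `1`-complemented if it is the range of a linear projection of `X` of
norm at most one (the norm is exactly one unless `M = {0}`). -/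
def IsOneComplemented {𝕜 X : Type*} [RCLike 𝕜] [NormedAddCommGroup X] [NormedSpace 𝕜 X]
    (M : Submodule 𝕜 X) : Prop :=
  ∃ P : X →L[𝕜] X, ‖P‖ ≤ 1 ∧ (∀ x, P x ∈ M) ∧ ∀ x ∈ M, P x = x

/-- The metric `π`-property: every finite collection in the unit sphere can be approximated, with
arbitrary precision, inside a finite-dimensional `1`-complemented subspace. -/
def HasMetricPiProperty (𝕜 X : Type*) [RCLike 𝕜] [NormedAddCommGroup X] [NormedSpace 𝕜 X] :
    Prop :=
  ∀ ε : ℝ, 0 < ε → ∀ F : Finset X, (∀ x ∈ F, ‖x‖ = 1) →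
    ∃ M : Submodule 𝕜 X, FiniteDimensional 𝕜 M ∧ IsOneComplemented M ∧
      ∀ x ∈ F, ∃ x' ∈ M, ‖x - x'‖ < ε

/-- The algebraic tensor product `X ⊗ Y`, as a type of its own that carries the projective norm. -/
def AlgProjTensor (𝕜 X Y : Type*) [RCLike 𝕜] [NormedAddCommGroup X] [NormedSpace 𝕜 X]
    [NormedAddCommGroup Y] [NormedSpace 𝕜 Y] : Type _ :=
  X ⊗[𝕜] Y

namespace AlgProjTensor

variable {𝕜 X Y : Type*} [RCLike 𝕜] [NormedAddCommGroup X] [NormedSpace 𝕜 X]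
  [NormedAddCommGroup Y] [NormedSpace 𝕜 Y]

instance : AddCommGroup (AlgProjTensor 𝕜 X Y) :=
  inferInstanceAs (AddCommGroup (X ⊗[𝕜] Y))

instance : Module 𝕜 (AlgProjTensor 𝕜 X Y) :=
  inferInstanceAs (Module 𝕜 (X ⊗[𝕜] Y))

/-- The elementary tensor `x ⊗ y` in `X ⊗ Y`. -/
def tmul (𝕜 : Type*) {X Y : Type*} [RCLike 𝕜] [NormedAddCommGroup X] [NormedSpace 𝕜 X]
    [NormedAddCommGroup Y] [NormedSpace 𝕜 Y] (x : X) (y : Y) : AlgProjTensor 𝕜 X Y :=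
  (x ⊗ₜ[𝕜] y : X ⊗[𝕜] Y)

/-- The values `∑ ‖xᵢ‖ ‖yᵢ‖` over all representations `u = ∑ xᵢ ⊗ yᵢ` as a finite sum. -/
def repValues (u : AlgProjTensor 𝕜 X Y) : Set ℝ :=
  {r | ∃ (n : ℕ) (x : Fin n → X) (y : Fin n → Y),
    u = ∑ i, tmul 𝕜 (x i) (y i) ∧ r = ∑ i, ‖x i‖ * ‖y i‖}

/-- The projective norm `‖u‖_π = inf ∑ ‖xᵢ‖ ‖yᵢ‖`. -/
instance : Norm (AlgProjTensor 𝕜 X Y) :=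
  ⟨fun u => sInf (repValues u)⟩

theorem norm_def (u : AlgProjTensor 𝕜 X Y) : ‖u‖ = sInf (repValues u) := rfl

theorem smul_tmul (c : 𝕜) (x : X) (y : Y) : c • tmul 𝕜 x y = tmul 𝕜 (c • x) y := rfl

theorem repValues_nonneg {u : AlgProjTensor 𝕜 X Y} {r : ℝ} (hr : r ∈ repValues u) : 0 ≤ r := by
  obtain ⟨n, x, y, -, rfl⟩ := hr
  positivity

theorem bddBelow_repValues (u : AlgProjTensor 𝕜 X Y) : BddBelow (repValues u) :=
  ⟨0, fun _ hr => repValues_nonneg hr⟩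

theorem add_mem_repValues {u v : AlgProjTensor 𝕜 X Y} {r s : ℝ} (hr : r ∈ repValues u)
    (hs : s ∈ repValues v) : r + s ∈ repValues (u + v) := by
  obtain ⟨n, x, y, rfl, rfl⟩ := hr
  obtain ⟨m, x', y', rfl, rfl⟩ := hs
  exact ⟨n + m, Fin.append x x', Fin.append y y', by simp [Fin.sum_univ_add],
    by simp [Fin.sum_univ_add]⟩

theorem smul_mem_repValues (c : 𝕜) {u : AlgProjTensor 𝕜 X Y} {r : ℝ} (hr : r ∈ repValues u) :
    ‖c‖ * r ∈ repValues (c • u) := by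
  obtain ⟨n, x, y, rfl, rfl⟩ := hr
  exact ⟨n, fun i => c • x i, y, by simp [Finset.smul_sum, smul_tmul],
    by simp [Finset.mul_sum, norm_smul, mul_assoc]⟩

theorem repValues_nonempty (u : AlgProjTensor 𝕜 X Y) : (repValues u).Nonempty := by
  refine TensorProduct.induction_on (motive := fun u : X ⊗[𝕜] Y =>
    (repValues (𝕜 := 𝕜) (X := X) (Y := Y) u).Nonempty) u ?_ ?_ ?_
  · exact ⟨0, 0, Fin.elim0, Fin.elim0, by simp; rfl, by simp⟩
  · intro x y
    exact ⟨‖x‖ * ‖y‖, 1, fun _ => x, fun _ => y, by simp; rfl, by simp⟩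
  · rintro u v ⟨r, hr⟩ ⟨s, hs⟩
    exact ⟨r + s, add_mem_repValues hr hs⟩

theorem norm_nonneg' (u : AlgProjTensor 𝕜 X Y) : 0 ≤ ‖u‖ :=
  Real.sInf_nonneg fun _ hr => repValues_nonneg hr

theorem norm_add_le' (u v : AlgProjTensor 𝕜 X Y) : ‖u + v‖ ≤ ‖u‖ + ‖v‖ := by
  refine le_of_forall_pos_le_add fun ε hε => ?_
  obtain ⟨r, hr, hru⟩ := exists_lt_of_csInf_lt (repValues_nonempty u)
    (show sInf (repValues u) < ‖u‖ + ε / 2 by rw [norm_def]; linarith)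
  obtain ⟨s, hs, hsv⟩ := exists_lt_of_csInf_lt (repValues_nonempty v)
    (show sInf (repValues v) < ‖v‖ + ε / 2 by rw [norm_def]; linarith)
  have := csInf_le (bddBelow_repValues _) (add_mem_repValues hr hs)
  rw [norm_def (u + v)]
  linarith

theorem norm_smul_le' (c : 𝕜) (u : AlgProjTensor 𝕜 X Y) : ‖c • u‖ ≤ ‖c‖ * ‖u‖ := by
  refine le_of_forall_pos_le_add fun ε hε => ?_
  have hc : 0 < ‖c‖ + 1 := by positivity
  obtain ⟨r, hr, hru⟩ := exists_lt_of_csInf_lt (repValues_nonempty u)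
    (show sInf (repValues u) < ‖u‖ + ε / (‖c‖ + 1) by
      rw [norm_def]; linarith [div_pos hε hc])
  have h1 : ‖c • u‖ ≤ ‖c‖ * r := csInf_le (bddBelow_repValues _) (smul_mem_repValues c hr)
  have h2 : ‖c‖ * r ≤ ‖c‖ * (‖u‖ + ε / (‖c‖ + 1)) := by gcongr
  have h3 : ‖c‖ * (ε / (‖c‖ + 1)) ≤ ε := by
    rw [mul_div_assoc', div_le_iff₀ hc]
    nlinarith [norm_nonneg c]
  linarith [mul_add ‖c‖ ‖u‖ (ε / (‖c‖ + 1))]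

theorem norm_smul' (c : 𝕜) (u : AlgProjTensor 𝕜 X Y) : ‖c • u‖ = ‖c‖ * ‖u‖ := by
  refine le_antisymm (norm_smul_le' c u) ?_
  rcases eq_or_ne c 0 with rfl | hc
  · simpa using norm_nonneg' _
  · have h := norm_smul_le' c⁻¹ (c • u)
    rw [inv_smul_smul₀ hc, norm_inv] at h
    have hc' : 0 < ‖c‖ := norm_pos_iff.mpr hc
    calc ‖c‖ * ‖u‖ ≤ ‖c‖ * (‖c‖⁻¹ * ‖c • u‖) := by gcongr
      _ = ‖c • u‖ := by field_simp

theorem core : SeminormedSpace.Core 𝕜 (AlgProjTensor 𝕜 X Y) where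
  norm_nonneg := norm_nonneg'
  norm_smul := norm_smul'
  norm_triangle := norm_add_le'

instance : SeminormedAddCommGroup (AlgProjTensor 𝕜 X Y) :=
  SeminormedAddCommGroup.ofCore core

instance : NormedSpace 𝕜 (AlgProjTensor 𝕜 X Y) where
  norm_smul_le := norm_smul_le'

end AlgProjTensor

/-- The projective tensor product of `X` and `Y`: the completion of `X ⊗ Y` with respect to the
projective norm. -/
abbrev ProjTensor (𝕜 X Y : Type*) [RCLike 𝕜] [NormedAddCommGroup X] [NormedSpace 𝕜 X]
    [NormedAddCommGroup Y] [NormedSpace 𝕜 Y] : Type _ :=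
  UniformSpace.Completion (AlgProjTensor 𝕜 X Y)

/-- The elementary tensor `x ⊗ y` in the projective tensor product. -/
def ProjTensor.tmul (𝕜 : Type*) {X Y : Type*} [RCLike 𝕜] [NormedAddCommGroup X]
    [NormedSpace 𝕜 X] [NormedAddCommGroup Y] [NormedSpace 𝕜 Y] (x : X) (y : Y) :
    ProjTensor 𝕜 X Y :=
  (AlgProjTensor.tmul 𝕜 x y : UniformSpace.Completion (AlgProjTensor 𝕜 X Y))

/-- `z` attains its projective norm: there are bounded sequences `(xₙ)`, `(yₙ)` with
`∑ ‖xₙ‖ ‖yₙ‖ < ∞`, `z = ∑ xₙ ⊗ yₙ` and `‖z‖ = ∑ ‖xₙ‖ ‖yₙ‖`. -/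
def AttainsProjNorm {𝕜 X Y : Type*} [RCLike 𝕜] [NormedAddCommGroup X] [NormedSpace 𝕜 X]
    [NormedAddCommGroup Y] [NormedSpace 𝕜 Y] (z : ProjTensor 𝕜 X Y) : Prop :=
  ∃ (x : ℕ → X) (y : ℕ → Y),
    Bornology.IsBounded (Set.range x) ∧ Bornology.IsBounded (Set.range y) ∧
    HasSum (fun n => ProjTensor.tmul 𝕜 (x n) (y n)) z ∧
    HasSum (fun n => ‖x n‖ * ‖y n‖) ‖z‖

/-- The set of norm-attaining tensors. -/
def normAttainingTensors (𝕜 X Y : Type*) [RCLike 𝕜] [NormedAddCommGroup X] [NormedSpace 𝕜 X]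
    [NormedAddCommGroup Y] [NormedSpace 𝕜 Y] : Set (ProjTensor 𝕜 X Y) :=
  {z | AttainsProjNorm z}

end

/-! If `P` and `Q` are contractive projections, a tensor `z` fixed by `P ⊗ Q` has almost optimal
representations `∑ aᵢ ⊗ bᵢ` inside the two ranges, since applying `P ⊗ Q` to a representation does
not increase its cost. Such tensors are dense in the projective tensor product, by the metric
π-property (with `Q` the identity when `Y` is uniformly convex).

Let `φ` be a norm-one functional norming `z`. In an almost optimal representation most of the mass
sits on pairs almost normed by `φ`. Compactness (`IsNormingCompact.exists_norming_near`) moves each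
of these to a nearby pair on which `φ` is exactly normed; the remaining pairs are dropped. All
surviving terms are normed by the same `φ`, so their sum attains its norm
(`attainsProjNorm_sum_of_dual`) and is close to `z` (`coe_mem_closure_normAttainingTensors`). -/

open Filter Topology

/-! ### Compactness of almost norming sequences and pairs. -/

section NormingCompact

variable {𝕜 X Y : Type*} [RCLike 𝕜] [NormedAddCommGroup X] [NormedSpace 𝕜 X]
  [NormedAddCommGroup Y] [NormedSpace 𝕜 Y]

/-- Sequences in the part of the unit ball lying in `T` that are asymptotically norming for a
functional of norm at most one have convergent subsequences. -/
def IsNormingCompact (𝕜 : Type*) {Y : Type*} [RCLike 𝕜] [NormedAddCommGroup Y] [NormedSpace 𝕜 Y]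
    (T : Set Y) : Prop :=
  ∀ f : Y →L[𝕜] 𝕜, ‖f‖ ≤ 1 → ∀ y : ℕ → Y, (∀ n, y n ∈ T) → (∀ n, ‖y n‖ ≤ 1) →
    Tendsto (fun n => RCLike.re (f (y n))) atTop (𝓝 1) →
    ∃ y₀ : Y, ∃ g : ℕ → ℕ, StrictMono g ∧ Tendsto (y ∘ g) atTop (𝓝 y₀)

theorem Submodule.exists_tendsto_subseq_of_finiteDimensional (M : Submodule 𝕜 X)
    [FiniteDimensional 𝕜 M] (x : ℕ → X) (hM : ∀ n, x n ∈ M) (hx : ∀ n, ‖x n‖ ≤ 1) :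
    ∃ x₀ : X, ∃ g : ℕ → ℕ, StrictMono g ∧ Tendsto (x ∘ g) atTop (𝓝 x₀) := by
  have : ProperSpace M := FiniteDimensional.proper 𝕜 M
  obtain ⟨a, -, g, hg, h⟩ := tendsto_subseq_of_bounded (s := Metric.closedBall (0 : M) 1)
    Metric.isBounded_closedBall (x := fun n => (⟨x n, hM n⟩ : M))
    (fun n => by simpa using hx n)
  exact ⟨a, g, hg, (continuous_subtype_val.tendsto a).comp h⟩

theorem Submodule.isNormingCompact (M : Submodule 𝕜 Y) [FiniteDimensional 𝕜 M] :
    IsNormingCompact 𝕜 (M : Set Y) :=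
  fun _ _ y hM hy _ => M.exists_tendsto_subseq_of_finiteDimensional y hM hy

/-- If `f` is almost 1 at two points of the unit ball, their sum has norm almost 2, so uniform
convexity makes them close. An asymptotically norming sequence is therefore Cauchy. -/
theorem isNormingCompact_univ_of_uniformConvexSpace [CompleteSpace Y] [UniformConvexSpace Y] :
    IsNormingCompact 𝕜 (Set.univ : Set Y) := by
  intro f hf y _ hy hlim
  let _ : NormedSpace ℝ Y := NormedSpace.restrictScalars ℝ 𝕜 Y
  have hc : CauchySeq y := by
    rw [Metric.cauchySeq_iff]
    intro ε hε
    obtain ⟨δ, hδ, h⟩ := exists_forall_closed_ball_dist_add_le_two_sub Y hε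
    obtain ⟨N, hN⟩ := eventually_atTop.mp
      (hlim.eventually (lt_mem_nhds (show 1 - δ / 2 < 1 by linarith)))
    refine ⟨N, fun m hm n hn => ?_⟩
    by_contra hcon
    rw [not_lt, dist_eq_norm] at hcon
    have h1 := h (hy m) (hy n) hcon
    have h2 : RCLike.re (f (y m + y n)) ≤ ‖y m + y n‖ :=
      (RCLike.re_le_norm _).trans
        ((f.le_opNorm _).trans (mul_le_of_le_one_left (norm_nonneg _) hf))
    rw [map_add, map_add] at h2
    linarith [hN m hm, hN n hn]
  obtain ⟨y₀, h₀⟩ := cauchySeq_tendsto_of_complete hc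
  exact ⟨y₀, id, strictMono_id, h₀⟩

theorem eq_one_of_one_le_re_of_norm_le_one {c : 𝕜} (h : 1 ≤ RCLike.re c) (h' : ‖c‖ ≤ 1) :
    c = 1 := by
  have h1 : RCLike.re c = 1 := le_antisymm ((RCLike.re_le_norm c).trans h') h
  have h2 : ((RCLike.re c : ℝ) : 𝕜) = c := RCLike.re_eq_self_of_le (h'.trans h)
  rw [← h2, h1, RCLike.ofReal_one]

/-- Almost norming pairs of a bilinear form are close to pairs at which the norm is attained. -/
theorem IsNormingCompact.exists_norming_near {M : Submodule 𝕜 X} [FiniteDimensional 𝕜 M]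
    {T : Set Y} (hT : IsNormingCompact 𝕜 T) (B : X →L[𝕜] Y →L[𝕜] 𝕜) (hB : ‖B‖ ≤ 1)
    {ε : ℝ} (hε : 0 < ε) :
    ∃ η : ℝ, 0 < η ∧ ∀ x ∈ M, ∀ y ∈ T, ‖x‖ ≤ 1 → ‖y‖ ≤ 1 → 1 - η < RCLike.re (B x y) →
      ∃ x' y', ‖x'‖ ≤ 1 ∧ ‖y'‖ ≤ 1 ∧ B x' y' = 1 ∧ ‖x - x'‖ < ε ∧ ‖y - y'‖ < ε := by
  -- The failure of every `η = 1 / (n + 1)` yields a sequence of bad pairs, which a limit pair will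
  -- contradict.
  by_contra! hcon
  have hpos : ∀ n : ℕ, (0 : ℝ) < 1 / ((n : ℝ) + 1) := fun n => by positivity
  choose x hxM y hyT hx hy hre hno using fun n : ℕ => hcon _ (hpos n)
  have hBle : ∀ a b, ‖B a b‖ ≤ ‖a‖ * ‖b‖ := fun a b =>
    (B.le_opNorm₂ a b).trans (by
      rw [mul_assoc]; exact mul_le_of_le_one_left (by positivity) hB)
  have hle1 : ∀ a b, ‖a‖ ≤ 1 → ‖b‖ ≤ 1 → ‖B a b‖ ≤ 1 := fun a b ha hb =>
    (hBle a b).trans (mul_le_one₀ ha (norm_nonneg _) hb)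
  have hlim : Tendsto (fun n => RCLike.re (B (x n) (y n))) atTop (𝓝 1) := by
    refine tendsto_of_tendsto_of_tendsto_of_le_of_le (g := fun n : ℕ => 1 - 1 / ((n : ℝ) + 1))
      (h := fun _ => 1) ?_ tendsto_const_nhds (fun n => (hre n).le)
      (fun n => (RCLike.re_le_norm _).trans (hle1 _ _ (hx n) (hy n)))
    simpa using tendsto_const_nhds.sub (tendsto_one_div_add_atTop_nhds_zero_nat (𝕜 := ℝ))
  obtain ⟨x₀, g, hg, hxg⟩ := M.exists_tendsto_subseq_of_finiteDimensional x hxM hx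
  have hx₀ : ‖x₀‖ ≤ 1 := le_of_tendsto' hxg.norm fun n => hx _
  -- Replacing `x (g n)` by its limit makes the `y (g n)` asymptotically norming for the single
  -- functional `B x₀`, as the compactness hypothesis on `T` requires.
  have hdiff : Tendsto (fun n => RCLike.re (B (x₀ - x (g n)) (y (g n)))) atTop (𝓝 0) := by
    have h0 : Tendsto (fun n => ‖x₀ - x (g n)‖) atTop (𝓝 0) := by
      simpa using (tendsto_const_nhds (x := x₀).sub hxg).norm
    refine squeeze_zero_norm (fun n => ?_) h0
    exact (RCLike.norm_re_le_norm _).trans ((hBle _ _).trans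
      (mul_le_of_le_one_right (norm_nonneg _) (hy _)))
  have hf : Tendsto (fun n => RCLike.re (B x₀ (y (g n)))) atTop (𝓝 1) := by
    have := hdiff.add (hlim.comp hg.tendsto_atTop)
    rw [zero_add] at this
    refine this.congr fun n => ?_
    simp
  have hBx : ‖B x₀‖ ≤ 1 := (B.le_opNorm x₀).trans (mul_le_one₀ hB (norm_nonneg _) hx₀)
  obtain ⟨y₀, g', hg', hyg⟩ := hT (B x₀) hBx (y ∘ g) (fun n => hyT _) (fun n => hy _) hf
  have hy₀ : ‖y₀‖ ≤ 1 := le_of_tendsto' hyg.norm fun n => hy _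
  have hre₀ : RCLike.re (B x₀ y₀) = 1 :=
    tendsto_nhds_unique
      ((RCLike.continuous_re.tendsto _).comp (((B x₀).continuous.tendsto y₀).comp hyg))
      (hf.comp hg'.tendsto_atTop)
  have h1 : B x₀ y₀ = 1 :=
    eq_one_of_one_le_re_of_norm_le_one hre₀.ge (hle1 _ _ hx₀ hy₀)
  have hxe := (hxg.comp hg'.tendsto_atTop).eventually (Metric.ball_mem_nhds x₀ hε)
  have hye := hyg.eventually (Metric.ball_mem_nhds y₀ hε)
  obtain ⟨n, hxn, hyn⟩ := (hxe.and hye).exists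
  simp only [Function.comp_apply, dist_eq_norm] at hxn hyn
  exact absurd hyn (not_lt.mpr (hno _ x₀ y₀ hx₀ hy₀ h1 hxn))

end NormingCompact

/-! ### From unit vectors to arbitrary finite families. -/

section PiProperty

variable {𝕜 X : Type*} [RCLike 𝕜] [NormedAddCommGroup X] [NormedSpace 𝕜 X]

/-- The metric `π`-property in terms of projections, for arbitrary finite families. -/
theorem HasMetricPiProperty.exists_projection (h : HasMetricPiProperty 𝕜 X) {ι : Type*}
    [Finite ι] (x : ι → X) {ε : ℝ} (hε : 0 < ε) :
    ∃ (M : Submodule 𝕜 X) (P : X →L[𝕜] X), FiniteDimensional 𝕜 M ∧ ‖P‖ ≤ 1 ∧ (∀ x, P x ∈ M) ∧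
      (∀ x ∈ M, P x = x) ∧ ∀ i, ‖x i - P (x i)‖ < ε := by
  classical
  cases nonempty_fintype ι
  set S : ℝ := ∑ i, ‖x i‖
  have hS : 0 ≤ S := by positivity
  set u : ι → X := fun i => ((‖x i‖⁻¹ : ℝ) : 𝕜) • x i
  have hxu : ∀ i, x i = ((‖x i‖ : ℝ) : 𝕜) • u i := fun i => by
    rcases eq_or_ne (x i) 0 with h0 | h0
    · simp [h0]
    · simp only [u, smul_smul, ← RCLike.ofReal_mul]
      rw [mul_inv_cancel₀ (norm_ne_zero_iff.mpr h0)]; simp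
  -- The 2 pays for passing from a nearby `v ∈ M` to `P (u i)`, and `S` bounds the norms lost in
  -- normalizing. The filter removes the zero vectors, whose normalization is 0.
  obtain ⟨M, hM, ⟨P, hP, hPM, hPid⟩, hF⟩ := h (ε / (2 * (S + 1))) (by positivity)
    ((Finset.univ.image u).filter fun v => ‖v‖ = 1) (by simp)
  refine ⟨M, P, hM, hP, hPM, hPid, fun i => ?_⟩
  rcases eq_or_ne (x i) 0 with h0 | h0
  · simpa [h0] using hε
  have hu : ‖u i‖ = 1 := by
    simp only [u, norm_smul, RCLike.norm_ofReal, abs_inv, abs_norm]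
    exact inv_mul_cancel₀ (norm_ne_zero_iff.mpr h0)
  obtain ⟨v, hv, hvu⟩ := hF (u i) (by simp [hu])
  have h1 : ‖u i - P (u i)‖ ≤ 2 * ‖u i - v‖ := by
    have : u i - P (u i) = (u i - v) - P (u i - v) := by rw [map_sub, hPid v hv]; abel
    rw [this]
    have := (P.le_opNorm (u i - v)).trans (mul_le_of_le_one_left (norm_nonneg _) hP)
    linarith [norm_sub_le (u i - v) (P (u i - v))]
  have h2 : ‖u i - P (u i)‖ < ε / (S + 1) := by
    have : 2 * (ε / (2 * (S + 1))) = ε / (S + 1) := by field_simp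
    linarith
  have h3 : ‖x i‖ ≤ S :=
    Finset.single_le_sum (f := fun i => ‖x i‖) (fun _ _ => norm_nonneg _) (Finset.mem_univ i)
  have h4 : ‖x i - P (x i)‖ = ‖x i‖ * ‖u i - P (u i)‖ := by
    conv_lhs => rw [hxu i, map_smul, ← smul_sub, norm_smul]
    simp
  rw [h4]
  calc ‖x i‖ * ‖u i - P (u i)‖ < ‖x i‖ * (ε / (S + 1)) := by
        have := norm_pos_iff.mpr h0
        gcongr
    _ ≤ (S + 1) * (ε / (S + 1)) := by gcongr; linarith
    _ = ε := by field_simp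

end PiProperty

/-! ### Representations, norm attainment and density in the projective tensor product. -/

section ProjTensor

variable {𝕜 X Y : Type*} [RCLike 𝕜] [NormedAddCommGroup X] [NormedSpace 𝕜 X]
  [NormedAddCommGroup Y] [NormedSpace 𝕜 Y]

theorem AlgProjTensor.norm_tmul_le (x : X) (y : Y) : ‖AlgProjTensor.tmul 𝕜 x y‖ ≤ ‖x‖ * ‖y‖ :=
  csInf_le (bddBelow_repValues _) ⟨1, fun _ => x, fun _ => y, by simp, by simp⟩

/-- The tensor product of two operators, on the algebraic tensor product. -/
def AlgProjTensor.map (P : X →ₗ[𝕜] X) (Q : Y →ₗ[𝕜] Y) :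
    AlgProjTensor 𝕜 X Y →ₗ[𝕜] AlgProjTensor 𝕜 X Y :=
  (TensorProduct.map P Q : X ⊗[𝕜] Y →ₗ[𝕜] X ⊗[𝕜] Y)

theorem AlgProjTensor.map_tmul (P : X →ₗ[𝕜] X) (Q : Y →ₗ[𝕜] Y) (x : X) (y : Y) :
    AlgProjTensor.map P Q (AlgProjTensor.tmul 𝕜 x y) = AlgProjTensor.tmul 𝕜 (P x) (Q y) := rfl

/-- A tensor in the range of `P ⊗ Q` has almost optimal representations in the ranges. -/
theorem AlgProjTensor.exists_rep_lt_of_map_eq_self {P : X →L[𝕜] X} {Q : Y →L[𝕜] Y}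
    (hP : ‖P‖ ≤ 1) (hQ : ‖Q‖ ≤ 1) {z : AlgProjTensor 𝕜 X Y}
    (hz : AlgProjTensor.map (P : X →ₗ[𝕜] X) (Q : Y →ₗ[𝕜] Y) z = z) {δ : ℝ} (hδ : 0 < δ) :
    ∃ (n : ℕ) (a : Fin n → X) (b : Fin n → Y),
      z = ∑ i, AlgProjTensor.tmul 𝕜 (P (a i)) (Q (b i)) ∧
      ∑ i, ‖P (a i)‖ * ‖Q (b i)‖ < ‖z‖ + δ := by
  obtain ⟨r, ⟨n, a, b, hab, rfl⟩, hr⟩ := exists_lt_of_csInf_lt (repValues_nonempty z)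
    (show sInf (repValues z) < ‖z‖ + δ by rw [norm_def]; linarith)
  refine ⟨n, a, b, ?_, lt_of_le_of_lt (Finset.sum_le_sum fun i _ => ?_) hr⟩
  · conv_lhs => rw [← hz, hab, map_sum]
    rfl
  · exact mul_le_mul ((P.le_opNorm _).trans (mul_le_of_le_one_left (norm_nonneg _) hP))
      ((Q.le_opNorm _).trans (mul_le_of_le_one_left (norm_nonneg _) hQ)) (norm_nonneg _)
      (norm_nonneg _)

namespace ProjTensor

theorem tmul_add (x : X) (y y' : Y) : tmul 𝕜 x (y + y') = tmul 𝕜 x y + tmul 𝕜 x y' := by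
  rw [tmul, tmul, tmul, ← UniformSpace.Completion.coe_add]
  exact congrArg _ (TensorProduct.tmul_add x y y')

theorem add_tmul (x x' : X) (y : Y) : tmul 𝕜 (x + x') y = tmul 𝕜 x y + tmul 𝕜 x' y := by
  rw [tmul, tmul, tmul, ← UniformSpace.Completion.coe_add]
  exact congrArg _ (TensorProduct.add_tmul x x' y)

theorem smul_tmul (c : 𝕜) (x : X) (y : Y) : tmul 𝕜 (c • x) y = c • tmul 𝕜 x y := by
  rw [tmul, tmul, ← UniformSpace.Completion.coe_smul]
  rfl

theorem tmul_smul (c : 𝕜) (x : X) (y : Y) : tmul 𝕜 x (c • y) = c • tmul 𝕜 x y := by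
  rw [tmul, tmul, ← UniformSpace.Completion.coe_smul]
  exact congrArg _ (TensorProduct.tmul_smul c x y)

theorem norm_tmul_le (x : X) (y : Y) : ‖tmul 𝕜 x y‖ ≤ ‖x‖ * ‖y‖ := by
  rw [tmul, UniformSpace.Completion.norm_coe]
  exact AlgProjTensor.norm_tmul_le x y

/-- The canonical bilinear map into the projective tensor product. -/
noncomputable def mk (𝕜 X Y : Type*) [RCLike 𝕜] [NormedAddCommGroup X] [NormedSpace 𝕜 X]
    [NormedAddCommGroup Y] [NormedSpace 𝕜 Y] : X →L[𝕜] Y →L[𝕜] ProjTensor 𝕜 X Y :=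
  (LinearMap.mk₂ 𝕜 (tmul 𝕜) add_tmul smul_tmul tmul_add tmul_smul).mkContinuous₂ 1
    fun x y => by simpa using norm_tmul_le x y

theorem mk_apply (x : X) (y : Y) : mk 𝕜 X Y x y = tmul 𝕜 x y := rfl

theorem norm_tmul_sub_tmul_le (x x' : X) (y y' : Y) :
    ‖tmul 𝕜 x y - tmul 𝕜 x' y'‖ ≤ ‖x - x'‖ * ‖y‖ + ‖x'‖ * ‖y - y'‖ := by
  have : tmul 𝕜 x y - tmul 𝕜 x' y' = tmul 𝕜 (x - x') y + tmul 𝕜 x' (y - y') := by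
    simp only [← mk_apply, map_sub, sub_apply]; abel
  rw [this]
  exact (norm_add_le _ _).trans (add_le_add (norm_tmul_le _ _) (norm_tmul_le _ _))

theorem coe_sum_tmul {n : ℕ} (x : Fin n → X) (y : Fin n → Y) :
    ((∑ i, AlgProjTensor.tmul 𝕜 (x i) (y i) : AlgProjTensor 𝕜 X Y) : ProjTensor 𝕜 X Y) =
      ∑ i, tmul 𝕜 (x i) (y i) :=
  map_sum (UniformSpace.Completion.toComplₗᵢ (𝕜 := 𝕜) (E := AlgProjTensor 𝕜 X Y)) _ _

end ProjTensor

theorem Fin.isBounded_range_extend {E : Type*} [NormedAddCommGroup E] {n : ℕ} (v : Fin n → E) :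
    Bornology.IsBounded (Set.range fun k : ℕ => if h : k < n then v ⟨k, h⟩ else 0) := by
  refine ((Set.finite_range v).insert 0).isBounded.subset ?_
  rintro _ ⟨k, rfl⟩
  by_cases hk : k < n <;> simp [hk]

theorem Fin.hasSum_of_eq_zero {E : Type*} [AddCommMonoid E] [TopologicalSpace E] {n : ℕ}
    (v : ℕ → E) (hv : ∀ k, n ≤ k → v k = 0) : HasSum v (∑ i : Fin n, v i) := by
  rw [Fin.sum_univ_eq_sum_range]
  exact hasSum_sum_of_ne_finset_zero fun k hk => hv k (by simpa using hk)

theorem attainsProjNorm_sum {n : ℕ} (x : Fin n → X) (y : Fin n → Y)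
    (h : ‖∑ i, ProjTensor.tmul 𝕜 (x i) (y i)‖ = ∑ i, ‖x i‖ * ‖y i‖) :
    AttainsProjNorm (∑ i, ProjTensor.tmul 𝕜 (x i) (y i)) := by
  -- The witnesses are the finite families extended by zero, so the added terms contribute nothing
  -- to either series.
  refine ⟨_, _, Fin.isBounded_range_extend x, Fin.isBounded_range_extend y, ?_, ?_⟩
  · convert Fin.hasSum_of_eq_zero (n := n) (fun k => ProjTensor.tmul 𝕜 (if h : k < n then x ⟨k, h⟩ else 0)
      (if h : k < n then y ⟨k, h⟩ else 0)) (fun k hk => by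
        simp [not_lt.mpr hk, ← ProjTensor.mk_apply]) using 1
    simp
  · rw [h]
    convert Fin.hasSum_of_eq_zero (n := n) (fun k => ‖(if h : k < n then x ⟨k, h⟩ else 0 : X)‖ *
      ‖(if h : k < n then y ⟨k, h⟩ else 0 : Y)‖) (fun k hk => by
        simp [not_lt.mpr hk]) using 1
    simp

/-- A finite sum of elementary tensors all normed by the same functional attains its norm. -/
theorem attainsProjNorm_sum_of_dual {φ : ProjTensor 𝕜 X Y →L[𝕜] 𝕜} (hφ : ‖φ‖ ≤ 1) {n : ℕ}
    (x : Fin n → X) (y : Fin n → Y)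
    (h : ∀ i, ‖x i‖ * ‖y i‖ ≤ RCLike.re (φ (ProjTensor.tmul 𝕜 (x i) (y i)))) :
    AttainsProjNorm (∑ i, ProjTensor.tmul 𝕜 (x i) (y i)) := by
  refine attainsProjNorm_sum x y (le_antisymm ?_ ?_)
  · exact (norm_sum_le _ _).trans (Finset.sum_le_sum fun i _ => ProjTensor.norm_tmul_le _ _)
  · calc ∑ i, ‖x i‖ * ‖y i‖ ≤ ∑ i, RCLike.re (φ (ProjTensor.tmul 𝕜 (x i) (y i))) :=
          Finset.sum_le_sum fun i _ => h i
      _ = RCLike.re (φ (∑ i, ProjTensor.tmul 𝕜 (x i) (y i))) := by simp [map_sum]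
      _ ≤ _ := (RCLike.re_le_norm _).trans
          ((φ.le_opNorm _).trans (mul_le_of_le_one_left (norm_nonneg _) hφ))

/-- Tensors fixed by `P ⊗ Q` are limits of norm-attaining tensors. -/
theorem coe_mem_closure_normAttainingTensors {M : Submodule 𝕜 X} [FiniteDimensional 𝕜 M]
    {P : X →L[𝕜] X} {Q : Y →L[𝕜] Y} (hP : ‖P‖ ≤ 1) (hPM : ∀ x, P x ∈ M) (hQ : ‖Q‖ ≤ 1)
    {N : Submodule 𝕜 Y} (hQN : ∀ y, Q y ∈ N) (hN : IsNormingCompact 𝕜 (N : Set Y))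
    {z : AlgProjTensor 𝕜 X Y}
    (hz : AlgProjTensor.map (P : X →ₗ[𝕜] X) (Q : Y →ₗ[𝕜] Y) z = z) :
    (z : ProjTensor 𝕜 X Y) ∈ closure (normAttainingTensors 𝕜 X Y) := by
  rw [Metric.mem_closure_iff]
  intro τ hτ
  obtain ⟨φ, hφ, hφz⟩ := exists_dual_vector'' 𝕜 (z : ProjTensor 𝕜 X Y)
  have hφle : ∀ w, ‖φ w‖ ≤ ‖w‖ := fun w =>
    (φ.le_opNorm w).trans (mul_le_of_le_one_left (norm_nonneg _) hφ)
  set B : X →L[𝕜] Y →L[𝕜] 𝕜 :=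
    (ContinuousLinearMap.compL 𝕜 Y (ProjTensor 𝕜 X Y) 𝕜 φ).comp (ProjTensor.mk 𝕜 X Y)
  have hBapp : ∀ x y, B x y = φ (ProjTensor.tmul 𝕜 x y) := fun x y => rfl
  have hB : ‖B‖ ≤ 1 := ContinuousLinearMap.opNorm_le_bound₂ _ zero_le_one fun x y => by
    rw [hBapp, one_mul]
    exact (hφle _).trans (ProjTensor.norm_tmul_le x y)
  -- Moving the good pairs costs at most `2 * ε * ∑ c i ≤ τ / 4`, once `δ ≤ 1` gives `∑ c i ≤ ‖z‖ +
  -- 1`. The bound `δ ≤ η * (τ / 4)` keeps the dropped pairs below another `τ / 4`.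
  set ε : ℝ := τ / (8 * (‖z‖ + 1)) with hεdef
  have hz0 : 0 ≤ ‖z‖ := norm_nonneg z
  have hε : 0 < ε := by positivity
  obtain ⟨η, hη, hnear⟩ := hN.exists_norming_near (M := M) B hB hε
  set δ : ℝ := min 1 (η * (τ / 4))
  have hδ : 0 < δ := by positivity
  obtain ⟨n, a, b, hab, hlt⟩ := AlgProjTensor.exists_rep_lt_of_map_eq_self hP hQ hz hδ
  set c : Fin n → ℝ := fun i => ‖P (a i)‖ * ‖Q (b i)‖ with hc
  -- One bound serves both kinds of pair: the first summand is the cost of moving a good pair; the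
  -- second, a Markov inequality, dominates the mass `c i` of a bad one. The defects `c i - re B`
  -- sum to less than `δ`.
  have key : ∀ i, ∃ (x : X) (y : Y),
      ‖x‖ * ‖y‖ ≤ RCLike.re (φ (ProjTensor.tmul 𝕜 x y)) ∧
      ‖ProjTensor.tmul 𝕜 (P (a i)) (Q (b i)) - ProjTensor.tmul 𝕜 x y‖ ≤
        2 * ε * c i + (c i - RCLike.re (B (P (a i)) (Q (b i)))) / η := by
    intro i
    have hci : 0 ≤ c i := by positivity
    by_cases hgood : (1 - η) * c i < RCLike.re (B (P (a i)) (Q (b i)))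
    · have hBi : RCLike.re (B (P (a i)) (Q (b i))) ≤ c i :=
        (RCLike.re_le_norm _).trans ((hφle _).trans (ProjTensor.norm_tmul_le _ _))
      have hpos : 0 < c i := by
        rcases hci.eq_or_lt with h | h
        · rw [← h, mul_zero] at hgood
          rw [← h] at hBi
          exact absurd hgood (not_lt.mpr hBi)
        · exact h
      have ha : 0 < ‖P (a i)‖ := pos_of_mul_pos_left hpos (norm_nonneg _)
      have hb : 0 < ‖Q (b i)‖ := pos_of_mul_pos_right hpos (norm_nonneg _)
      set u : X := ((‖P (a i)‖⁻¹ : ℝ) : 𝕜) • P (a i) with hu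
      set v : Y := ((‖Q (b i)‖⁻¹ : ℝ) : 𝕜) • Q (b i) with hv
      have hu1 : ‖u‖ = 1 := by
        simp only [hu, norm_smul, RCLike.norm_ofReal, abs_inv, abs_norm]
        exact inv_mul_cancel₀ ha.ne'
      have hv1 : ‖v‖ = 1 := by
        simp only [hv, norm_smul, RCLike.norm_ofReal, abs_inv, abs_norm]
        exact inv_mul_cancel₀ hb.ne'
      have htm : ProjTensor.tmul 𝕜 (P (a i)) (Q (b i)) =
          ((c i : ℝ) : 𝕜) • ProjTensor.tmul 𝕜 u v := by
        rw [hu, hv, ProjTensor.smul_tmul, ProjTensor.tmul_smul, smul_smul, smul_smul,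
          ← RCLike.ofReal_mul, ← RCLike.ofReal_mul]
        have : c i * ‖P (a i)‖⁻¹ * ‖Q (b i)‖⁻¹ = 1 := by
          simp only [hc]; field_simp
        rw [this]; simp
      have hBc : RCLike.re (B (P (a i)) (Q (b i))) = c i * RCLike.re (B u v) := by
        rw [hBapp, htm, map_smul, smul_eq_mul, RCLike.re_ofReal_mul, hBapp]
      rw [hBc, mul_comm] at hgood
      obtain ⟨x', y', hx', hy', hxy, hux, hvy⟩ := hnear u (M.smul_mem _ (hPM _)) v
        (N.smul_mem _ (hQN _)) hu1.le hv1.le (lt_of_mul_lt_mul_left hgood hci)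
      -- The whole weight `c i` of the normalized pair is put on the first factor.
      refine ⟨((c i : ℝ) : 𝕜) • x', y', ?_, ?_⟩
      · rw [ProjTensor.smul_tmul, map_smul, ← hBapp, hxy, norm_smul, RCLike.norm_ofReal,
          abs_of_nonneg hci]
        simp only [smul_eq_mul, mul_one, RCLike.ofReal_re]
        rw [mul_assoc]
        exact mul_le_of_le_one_right hci (mul_le_one₀ hx' (norm_nonneg _) hy')
      · rw [ProjTensor.smul_tmul, htm, ← smul_sub, norm_smul, RCLike.norm_ofReal,
          abs_of_nonneg hci]
        have h1 : ‖ProjTensor.tmul 𝕜 u v - ProjTensor.tmul 𝕜 x' y'‖ ≤ 2 * ε := by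
          refine (ProjTensor.norm_tmul_sub_tmul_le u x' v y').trans ?_
          rw [hv1, mul_one]
          have := mul_le_of_le_one_left (norm_nonneg (v - y')) hx'
          linarith
        have h2 : 0 ≤ (c i - RCLike.re (B (P (a i)) (Q (b i)))) / η :=
          div_nonneg (sub_nonneg.mpr hBi) hη.le
        have h3 := mul_le_mul_of_nonneg_left h1 hci
        linarith
    · refine ⟨0, 0, by simp [← ProjTensor.mk_apply], ?_⟩
      have h0 : ProjTensor.tmul 𝕜 (0 : X) (0 : Y) = 0 := by simp [← ProjTensor.mk_apply]
      rw [h0, sub_zero]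
      have h1 : c i ≤ (c i - RCLike.re (B (P (a i)) (Q (b i)))) / η := by
        rw [le_div_iff₀ hη]; linarith
      have h2 : ‖ProjTensor.tmul 𝕜 (P (a i)) (Q (b i))‖ ≤ c i := ProjTensor.norm_tmul_le _ _
      have h3 : 0 ≤ 2 * ε * c i := by positivity
      linarith
  choose x y hxy hdist using key
  refine ⟨_, attainsProjNorm_sum_of_dual hφ x y hxy, ?_⟩
  have hzsum : (z : ProjTensor 𝕜 X Y) = ∑ i, ProjTensor.tmul 𝕜 (P (a i)) (Q (b i)) := by
    rw [← ProjTensor.coe_sum_tmul, ← hab]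
  have hre : ∑ i, RCLike.re (B (P (a i)) (Q (b i))) = ‖z‖ := by
    simp only [hBapp]
    rw [← map_sum, ← map_sum, ← hzsum, hφz, RCLike.ofReal_re, UniformSpace.Completion.norm_coe]
  have hbound : dist (z : ProjTensor 𝕜 X Y) (∑ i, ProjTensor.tmul 𝕜 (x i) (y i)) ≤
      2 * ε * (∑ i, c i) + (∑ i, c i - ‖z‖) / η := by
    rw [dist_eq_norm, hzsum, ← Finset.sum_sub_distrib, ← hre, ← Finset.sum_sub_distrib,
      Finset.mul_sum, Finset.sum_div, ← Finset.sum_add_distrib]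
    exact (norm_sum_le _ _).trans (Finset.sum_le_sum fun i _ => hdist i)
  have h1 : 2 * ε * (∑ i, c i) ≤ 2 * ε * (‖z‖ + 1) := by
    have : δ ≤ 1 := min_le_left _ _
    gcongr
    linarith
  have h2 : 2 * ε * (‖z‖ + 1) = τ / 4 := by
    rw [hεdef]; field_simp; norm_num
  have h3 : (∑ i, c i - ‖z‖) / η ≤ τ / 4 := by
    rw [div_le_iff₀ hη]
    have : δ ≤ η * (τ / 4) := min_le_right _ _
    linarith
  linarith

/-- Density of the norm-attaining tensors when `Y` has enough norming compact projections. -/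
theorem closure_normAttainingTensors_eq_univ (hX : HasMetricPiProperty 𝕜 X)
    (hY : ∀ (n : ℕ) (y : Fin n → Y) (ε : ℝ), 0 < ε → ∃ (N : Submodule 𝕜 Y) (Q : Y →L[𝕜] Y),
      IsNormingCompact 𝕜 (N : Set Y) ∧ ‖Q‖ ≤ 1 ∧ (∀ y, Q y ∈ N) ∧ (∀ y ∈ N, Q y = y) ∧
      ∀ i, ‖y i - Q (y i)‖ < ε) :
    closure (normAttainingTensors 𝕜 X Y) = Set.univ := by
  refine Set.eq_univ_of_forall fun w => ?_
  induction w using UniformSpace.Completion.induction_on with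
  | hp => exact isClosed_closure
  | ih z =>
    -- The approximants are only known to lie in the closure, so density is tested against the
    -- closure itself.
    rw [← closure_closure, Metric.mem_closure_iff]
    intro τ hτ
    obtain ⟨-, n, x, y, rfl, -⟩ := AlgProjTensor.repValues_nonempty z
    set S : ℝ := ∑ i, (‖x i‖ + ‖y i‖)
    have hS : 0 ≤ S := by positivity
    have hε : 0 < τ / (S + 1) := by positivity
    obtain ⟨M, P, hM, hP, hPM, hPid, hPx⟩ := hX.exists_projection x hε
    obtain ⟨N, Q, hN, hQ, hQN, hQid, hQy⟩ := hY n y _ hε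
    refine ⟨_, coe_mem_closure_normAttainingTensors hP hPM hQ hQN hN
      (z := ∑ i, AlgProjTensor.tmul 𝕜 (P (x i)) (Q (y i))) ?_, ?_⟩
    · simp [AlgProjTensor.map_tmul, hPid _ (hPM _), hQid _ (hQN _)]
    · rw [ProjTensor.coe_sum_tmul, ProjTensor.coe_sum_tmul, dist_eq_norm,
        ← Finset.sum_sub_distrib]
      calc _ ≤ ∑ i, τ / (S + 1) * (‖x i‖ + ‖y i‖) := by
            refine (norm_sum_le _ _).trans (Finset.sum_le_sum fun i _ => ?_)
            refine (ProjTensor.norm_tmul_sub_tmul_le _ _ _ _).trans ?_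
            have hPi : ‖P (x i)‖ ≤ ‖x i‖ :=
              (P.le_opNorm _).trans (mul_le_of_le_one_left (norm_nonneg _) hP)
            have h1 := mul_le_mul_of_nonneg_right (hPx i).le (norm_nonneg (y i))
            have h2 := mul_le_mul hPi (hQy i).le (norm_nonneg _) (norm_nonneg _)
            linarith
        _ = τ / (S + 1) * S := by rw [← Finset.mul_sum]
        _ < τ := by
            rw [div_mul_eq_mul_div, div_lt_iff₀ (by positivity)]
            nlinarith

end ProjTensor

/-! ### The two cases of the theorem. -/

theorem mainTheorem2 {𝕜 X Y : Type*} [RCLike 𝕜]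
    [NormedAddCommGroup X] [NormedSpace 𝕜 X] [CompleteSpace X]
    [NormedAddCommGroup Y] [NormedSpace 𝕜 Y] [CompleteSpace Y]
    (hX : HasMetricPiProperty 𝕜 X) :
    (HasMetricPiProperty 𝕜 Y → closure (normAttainingTensors 𝕜 X Y) = Set.univ) ∧
    (UniformConvexSpace Y → closure (normAttainingTensors 𝕜 X Y) = Set.univ) := by
  refine ⟨fun hY => ?_, fun hY => ?_⟩
  · refine closure_normAttainingTensors_eq_univ hX fun n y ε hε => ?_
    obtain ⟨N, Q, hN, hQ, hQN, hQid, hQy⟩ := hY.exists_projection y hε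
    exact ⟨N, Q, N.isNormingCompact, hQ, hQN, hQid, hQy⟩
  · refine closure_normAttainingTensors_eq_univ hX fun n y ε hε => ?_
    -- No approximation is needed in `Y`: uniform convexity makes the whole space norming compact.
    exact ⟨⊤, ContinuousLinearMap.id 𝕜 Y, isNormingCompact_univ_of_uniformConvexSpace,
      ContinuousLinearMap.norm_id_le, fun _ => Submodule.mem_top, fun _ _ => rfl,
      fun i => by simpa using hε⟩
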